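/- Let $F=\mathbb F_q$ be a finite field, let $n\ge 1$ and $t\ge 1$ be integers, and assume $(t,q)\neq(1,2)$. Let $\pi$ be an $n$-dimensional subspace of the projective space $\mathrm{PG}(n+t,q)$, all dimensions being projective. Let $X(n,t,q)$ be the incidence structure whose points are the $(t-1)$-dimensional subspaces of $\mathrm{PG}(n+t,q)$ skew to $\pi$, whose lines are the $t$-dimensional subspaces of $\mathrm{PG}(n+t,q)$ meeting $\pi$ in exactly one point, and whose incidence is containment. An automorphism of $X(n,t,q)$ is a pair consisting of a permutation of its points and a permutation of its lines that together preserve incidence and non-incidence. Let $\mathrm{P\Gamma L}(n+t+1,q)$ be the group of invertible semilinear maps of $\mathbb F_q^{\,n+t+1}$ modulo the nonzero scalars, acting on the subspaces of $\mathrm{PG}(n+t,q)$ (its elements are the collineations), and let $\mathrm{P\Gamma L}(n+t+1,q)_\pi$ be the stabiliser of $\pi$. Then every automorphism of $X(n,t,q)$ is induced by a collineation of $\mathrm{PG}(n+t,q)$ stabilising $\pi$. More precisely, letting each element of $\mathrm{P\Gamma L}(n+t+1,q)_\pi$ act on the points and the lines of $X(n,t,q)$ gives a group isomorphism $$\mathrm{P\Gamma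 L}(n+t+1,q)_\pi\;\cong\;\mathrm{Aut}(X(n,t,q)).$$ -/

import Mathlib

/-- A point-line incidence structure. -/
structure IncidenceStructure.{u} where
  Point : Type u
  Line : Type u
  Inc : Point → Line → Prop

/-- The automorphism group of an incidence structure: the pairs consisting of a permutation of the
points and a permutation of the lines that preserve incidence (in both directions). -/
def IncidenceStructure.Aut (X : IncidenceStructure) :
    Subgroup (Equiv.Perm X.Point × Equiv.Perm X.Line) where
  carrier := {ψ | ∀ P L, X.Inc (ψ.1 P) (ψ.2 L) ↔ X.Inc P L}
  one_mem' := fun _ _ => Iff.rfl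
  mul_mem' := by
    intro a b ha hb P L
    exact (ha (b.1 P) (b.2 L)).trans (hb P L)
  inv_mem' := by
    intro a ha P L
    have h := ha (a.1⁻¹ P) (a.2⁻¹ L)
    simpa using h.symm

/-- The group `ΓL(V)` of semilinear automorphisms of the `F`-vector space `V`: the additive
bijections `g` with `g (c • v) = σ c • g v` for some field automorphism `σ` of `F`. -/
def GammaL (F V : Type*) [Field F] [AddCommGroup V] [Module F V] : Subgroup (Equiv.Perm V) where
  carrier := {g | (∀ v w : V, g (v + w) = g v + g w) ∧
    ∃ σ : F ≃+* F, ∀ (c : F) (v : V), g (c • v) = σ c • g v}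
  one_mem' := ⟨fun _ _ => rfl, RingEquiv.refl F, fun _ _ => rfl⟩
  mul_mem' := by
    rintro a b ⟨ha', σ, ha⟩ ⟨hb', τ, hb⟩
    refine ⟨fun v w => by simp [ha', hb'], τ.trans σ, fun c v => ?_⟩
    simp [ha, hb]
  inv_mem' := by
    rintro a ⟨ha', σ, ha⟩
    refine ⟨fun v w => a.injective ?_, σ.symm, fun c v => a.injective ?_⟩
    · simp [ha']
    · simp [ha]

namespace GammaL

variable {F V : Type*} [Field F] [AddCommGroup V] [Module F V]

/-- The image `g(W)` of a subspace `W` under a semilinear automorphism `g`. -/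
def mapSubspace (g : GammaL F V) (W : Submodule F V) : Submodule F V where
  carrier := {v | ∃ w ∈ W, g.1 w = v}
  zero_mem' := ⟨0, W.zero_mem, by simpa using g.2.1 0 0⟩
  add_mem' := by
    rintro _ _ ⟨a, ha, rfl⟩ ⟨b, hb, rfl⟩
    exact ⟨a + b, W.add_mem ha hb, g.2.1 _ _⟩
  smul_mem' := by
    rintro c _ ⟨a, ha, rfl⟩
    obtain ⟨σ, hσ⟩ := g.2.2
    exact ⟨σ.symm c • a, W.smul_mem _ ha, by simp [hσ]⟩

instance : MulAction (GammaL F V) (Submodule F V) where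
  smul := mapSubspace
  one_smul W := by
    ext v
    exact ⟨fun ⟨_, hw, h⟩ => h ▸ hw, fun h => ⟨v, h, rfl⟩⟩
  mul_smul a b W := by
    ext v
    constructor
    · rintro ⟨w, hw, rfl⟩
      exact ⟨b.1 w, ⟨w, hw, rfl⟩, rfl⟩
    · rintro ⟨_, ⟨w, hw, rfl⟩, rfl⟩
      exact ⟨w, hw, rfl⟩

variable (F V) in
/-- The subgroup of `ΓL(V)` of the scalar maps `v ↦ c • v` with `c ≠ 0`. -/
def scalars : Subgroup (GammaL F V) where
  carrier := {g | ∃ c : F, c ≠ 0 ∧ ∀ v : V, g.1 v = c • v}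
  one_mem' := ⟨1, one_ne_zero, fun v => (one_smul F v).symm⟩
  mul_mem' := by
    rintro a b ⟨c, hc, ha⟩ ⟨d, hd, hb⟩
    exact ⟨c * d, mul_ne_zero hc hd, fun v => by simp [ha, hb, mul_smul]⟩
  inv_mem' := by
    rintro a ⟨c, hc, ha⟩
    refine ⟨c⁻¹, inv_ne_zero hc, fun v => ?_⟩
    change a.1.symm v = c⁻¹ • v
    rw [Equiv.symm_apply_eq, ha, smul_inv_smul₀ hc]

instance scalars_normal : (scalars F V).Normal where
  conj_mem := by
    rintro a ⟨c, hc, ha⟩ g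
    obtain ⟨σ, hσ⟩ := g.2.2
    exact ⟨σ c, by simpa using hc, fun v => by simp [ha, hσ]⟩

theorem scalars_le_ker :
    scalars F V ≤ (MulAction.toPermHom (GammaL F V) (Submodule F V)).ker := by
  rintro a ⟨c, hc, ha⟩
  rw [MonoidHom.mem_ker]
  ext W v
  constructor
  · rintro ⟨w, hw, rfl⟩
    rw [ha]
    exact W.smul_mem c hw
  · intro hv
    exact ⟨c⁻¹ • v, W.smul_mem _ hv, by simp [ha, hc]⟩

end GammaL

/-- The group `PΓL(V)` of collineations of the projective space `PG(V)`: semilinear automorphisms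
modulo nonzero scalars. -/
abbrev PGammaL (F V : Type*) [Field F] [AddCommGroup V] [Module F V] : Type _ :=
  GammaL F V ⧸ GammaL.scalars F V

/-- A collineation, i.e. the class of a semilinear map `g`, sends a subspace `W` to `g(W)`. -/
instance PGammaL.instMulAction (F V : Type*) [Field F] [AddCommGroup V] [Module F V] :
    MulAction (PGammaL F V) (Submodule F V) :=
  MulAction.compHom (Submodule F V)
    (QuotientGroup.lift (GammaL.scalars F V)
      (MulAction.toPermHom (GammaL F V) (Submodule F V)) GammaL.scalars_le_ker)

theorem PGammaL.mk_smul {F V : Type*} [Field F] [AddCommGroup V] [Module F V]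
    (g : GammaL F V) (W : Submodule F V) :
    (QuotientGroup.mk g : PGammaL F V) • W = GammaL.mapSubspace g W := rfl

/-- The geometry `X(n,t,q)` determined by a subspace `π` of `PG(V)`, where `V` is a vector space
over the field with `q` elements, of vector dimension `n + t + 1`, and `π` has vector
dimension `n + 1`. Projective dimension is vector dimension minus one: the points are the
`(t-1)`-spaces skew to `π`, the lines are the `t`-spaces meeting `π` in exactly one point, and
incidence is containment. -/
def geometryX {F V : Type*} [Field F] [AddCommGroup V] [Module F V]
    (π : Submodule F V) (t : ℕ) : IncidenceStructure where
  Point := {W : Submodule F V // Module.finrank F W = t ∧ W ⊓ π = ⊥}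
  Line := {W : Submodule F V // Module.finrank F W = t + 1 ∧
    Module.finrank F (W ⊓ π : Submodule F V) = 1}
  Inc := fun P L => P.1 ≤ L.1

/-- The automorphism `ψ` of `X(n,t,q)` is induced by the collineation `g`: it maps each point and
each line of the geometry, as a subspace, to its image under `g`. -/
def IsInducedBy {F V : Type*} [Field F] [AddCommGroup V] [Module F V]
    {π : Submodule F V} {t : ℕ} (ψ : (geometryX π t).Aut) (g : PGammaL F V) : Prop :=
  (∀ P : (geometryX π t).Point, (ψ.1.1 P).1 = g • P.1) ∧
    ∀ L : (geometryX π t).Line, (ψ.1.2 L).1 = g • L.1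

/-! Choose a complement `T` of `π`. Each point of the geometry is the graph of a unique linear map
`T → π`, and the points on a line are the coset `f + T* ⊗ p`, where `p` spans the point in which the
line meets `π`. An automorphism thus becomes a bijection `ψ` of `Hom(T, π)` carrying such cosets
onto such cosets, and the task is to show that `ψ` is semilinear up to a translation.

The crucial step is that parallel lines have parallel images (`direction_eq`). Two disjoint parallel
lines can be put in perspective from a third point, and a perspective configuration forces
parallelism (`span_eq_of_perspective`). The auxiliary point needs a functional different from `0`
and from a given one, so `|T*| = q^t ≥ 3`; this is where `(t, q) ≠ (1, 2)` enters.

Once directions are constant, parallelograms map to parallelograms, so `ψ - ψ 0` is additive.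
Comparing rank-one maps then gives `u ⊗ p ↦ α u ⊗ β p` (`exists_tensor_form`) with `α` and `β`
semilinear for one field automorphism. The inverse transpose `γ` of `α` acts on `T`, and `γ`, `β`
and the translation `ψ 0` glue to a semilinear bijection of `V` inducing the automorphism.
Faithfulness holds because a semilinear map fixing `π` and all graphs commutes with all maps `T →
π`, hence is scalar. -/

open Module Submodule

/-! ### Rank-one maps and the lines of `Hom(T, P)`. -/

section RankOne

variable {F T P : Type*} [Field F] [AddCommGroup T] [Module F T] [AddCommGroup P] [Module F P]

/-- The linear map `g` lies on the line through `f` consisting of the `f + u ⊗ p`. -/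
def OnLine (f : T →ₗ[F] P) (p : P) (g : T →ₗ[F] P) : Prop :=
  ∃ u : Dual F T, g = f + u.smulRight p

theorem OnLine.refl (f : T →ₗ[F] P) (p : P) : OnLine f p f :=
  ⟨0, by ext; simp⟩

theorem onLine_add (f : T →ₗ[F] P) (u : Dual F T) (p : P) : OnLine f p (f + u.smulRight p) :=
  ⟨u, rfl⟩

theorem OnLine.congr_base {f f' g : T →ₗ[F] P} {p : P} (h : OnLine f p f') :
    OnLine f p g ↔ OnLine f' p g := by
  obtain ⟨u, rfl⟩ := h
  constructor
  · rintro ⟨v, rfl⟩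
    exact ⟨v - u, by ext; simp [sub_smul]⟩
  · rintro ⟨v, rfl⟩
    exact ⟨u + v, by ext; simp [add_smul]; abel⟩

theorem onLine_iff_sub_mem {f g : T →ₗ[F] P} {p : P} :
    OnLine f p g ↔ ∀ x, g x - f x ∈ F ∙ p := by
  constructor
  · rintro ⟨u, rfl⟩ x
    exact mem_span_singleton.2 ⟨u x, by simp⟩
  · intro h
    by_cases hp : p = 0
    · subst hp
      refine ⟨0, ?_⟩
      ext x
      have := h x
      simpa [sub_eq_zero] using this
    · refine ⟨(LinearEquiv.toSpanNonzeroSingleton F P p hp).symm.toLinearMap ∘ₗ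
        (g - f).codRestrict (F ∙ p) h, ?_⟩
      ext x
      have := congrArg Subtype.val ((LinearEquiv.toSpanNonzeroSingleton F P p hp).apply_symm_apply
        ((g - f).codRestrict (F ∙ p) h x))
      simp only [LinearMap.add_apply, LinearMap.smulRight_apply, LinearMap.comp_apply]
      rw [LinearEquiv.toSpanNonzeroSingleton_apply] at this
      simp only [LinearEquiv.coe_coe]
      exact (add_eq_of_eq_sub' this).symm

theorem span_singleton_eq_of_smul_eq {p q : P} {a b : F} (ha : a ≠ 0) (hp : p ≠ 0)
    (h : a • p = b • q) : F ∙ p = F ∙ q := by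
  have hb : b ≠ 0 := by
    rintro rfl
    simp [ha, hp] at h
  have : p = (a⁻¹ * b) • q := by rw [mul_smul, ← h, inv_smul_smul₀ ha]
  rw [this]
  exact span_singleton_smul_eq (IsUnit.mk0 _ (by simp [ha, hb])) q

theorem linearIndependent_pair_or_span_eq {p q : P} (hp : p ≠ 0) (hq : q ≠ 0) :
    LinearIndependent F ![p, q] ∨ F ∙ p = F ∙ q := by
  by_cases h : LinearIndependent F ![p, q]
  · exact Or.inl h
  · rw [LinearIndependent.pair_iff' hp] at h
    push Not at h
    obtain ⟨a, rfl⟩ := h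
    right
    exact (span_singleton_smul_eq (IsUnit.mk0 a (by rintro rfl; simp at hq)) p).symm

theorem not_linearIndependent_of_span_eq {p q : P} (h : F ∙ p = F ∙ q) :
    ¬ LinearIndependent F ![p, q] := by
  intro hl
  have : p ∈ F ∙ q := h ▸ mem_span_singleton_self p
  obtain ⟨a, ha⟩ := mem_span_singleton.1 this
  have := LinearIndependent.pair_iff.1 hl 1 (-a) (by simp [ha])
  simp at this

theorem exists_dual_apply_ne_zero {u : Dual F T} (hu : u ≠ 0) : ∃ x, u x ≠ 0 := by
  by_contra! h
  exact hu (LinearMap.ext h)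

theorem span_eq_of_smulRight_eq {u w : Dual F T} {p q : P} (hu : u ≠ 0) (hp : p ≠ 0)
    (h : u.smulRight p = w.smulRight q) : F ∙ p = F ∙ q := by
  obtain ⟨x, hx⟩ := exists_dual_apply_ne_zero hu
  exact span_singleton_eq_of_smul_eq hx hp (by simpa using LinearMap.congr_fun h x)

theorem eq_zero_of_smulRight_eq {u w : Dual F T} {p q : P} (hl : LinearIndependent F ![p, q])
    (h : u.smulRight p = w.smulRight q) : u = 0 ∧ w = 0 := by
  have key (x : T) := LinearIndependent.pair_iff.1 hl (u x) (-(w x))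
    (by simpa [sub_eq_zero, ← sub_eq_add_neg] using LinearMap.congr_fun h x)
  exact ⟨LinearMap.ext fun x => (key x).1, LinearMap.ext fun x => by simpa using (key x).2⟩

theorem OnLine.congr_dir {f g : T →ₗ[F] P} {p q : P}
    (h : F ∙ p = F ∙ q) : OnLine f p g ↔ OnLine f q g := by
  rw [onLine_iff_sub_mem, onLine_iff_sub_mem, h]

/-- The difference of two points of the first line is a nonzero `u ⊗ p`, and it must also have the
form `w ⊗ q`; so a line determines its direction. -/
theorem span_eq_of_onLine_iff [Nontrivial (Dual F T)] {f f' : T →ₗ[F] P} {p q : P} (hp : p ≠ 0)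
    (h : ∀ g, OnLine f p g → OnLine f' q g) : F ∙ p = F ∙ q := by
  obtain ⟨u, hu⟩ := exists_ne (0 : Dual F T)
  obtain ⟨v, hv⟩ := h f (OnLine.refl f p)
  obtain ⟨w, hw⟩ := h _ (onLine_add f u p)
  refine span_eq_of_smulRight_eq (w := w - v) hu hp ?_
  rw [hv] at hw
  have e : u.smulRight p = w.smulRight q - v.smulRight q := by
    rw [add_assoc] at hw
    have := add_left_cancel hw
    rw [← this]; abel
  rw [e]; ext; simp [sub_smul]

/-- Every linear map is a sum of maps of rank at most one. -/
theorem linearMap_rankOne_induction [FiniteDimensional F T] {motive : (T →ₗ[F] P) → Prop}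
    (zero : motive 0) (step : ∀ f (u : Dual F T) p, motive f → motive (f + u.smulRight p))
    (f : T →ₗ[F] P) : motive f := by
  let b := finBasis F T
  have hf : f = ∑ i, (b.coord i).smulRight (f (b i)) := by
    refine b.ext fun j => ?_
    simp [LinearMap.sum_apply, Finsupp.single_apply, ite_smul]
  rw [hf]
  induction (Finset.univ : Finset (Fin (finrank F T))) using Finset.induction_on with
  | empty => simpa using zero
  | insert a s ha ih =>
    rw [Finset.sum_insert ha, add_comm]
    exact step _ _ _ ih

/-- If the points `a, a'` of one line and `b, b'` of another disjoint line are in perspective from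
a point `c`, then the two lines are parallel. -/
theorem span_eq_of_perspective {a a' b b' c : T →ₗ[F] P} {p p' r r' : P}
    (hp : p ≠ 0) (hp' : p' ≠ 0)
    (ha : OnLine c r a) (hb : OnLine c r b) (ha' : OnLine c r' a') (hb' : OnLine c r' b')
    (haa : OnLine a p a') (hbb : OnLine b p' b') (hna : a ≠ a') (hnb : b ≠ b')
    (hdisj : ∀ g, OnLine a p g → ¬ OnLine b p' g) : F ∙ p = F ∙ p' := by
  obtain ⟨u₁, rfl⟩ := ha
  obtain ⟨u₂, rfl⟩ := hb
  obtain ⟨u₃, rfl⟩ := ha'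
  obtain ⟨u₄, rfl⟩ := hb'
  obtain ⟨w, hw⟩ := haa
  obtain ⟨z, hz⟩ := hbb
  refine (linearIndependent_pair_or_span_eq hp hp').resolve_left fun hl => ?_
  have hw0 : w ≠ 0 := by
    rintro rfl
    exact hna (by rw [hw]; ext; simp)
  have hz0 : z ≠ 0 := by
    rintro rfl
    exact hnb (by rw [hz]; ext; simp)
  have hmem (w : Dual F T) (u v : Dual F T) (p : P) (hw0 : w ≠ 0)
      (hw : c + u.smulRight r' = c + v.smulRight r + w.smulRight p) :
      ∃ s s' : F, p = s • r + s' • r' := by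
    obtain ⟨x, hx⟩ := exists_dual_apply_ne_zero hw0
    have h1 := LinearMap.congr_fun hw x
    simp only [LinearMap.add_apply, LinearMap.smulRight_apply, add_assoc] at h1
    have h2 := add_left_cancel h1
    refine ⟨-((w x)⁻¹ * v x), (w x)⁻¹ * u x, ?_⟩
    rw [mul_smul _ (u x), h2, smul_add, inv_smul_smul₀ hx, neg_smul, mul_smul]
    abel
  -- Both `p` and `p'` lie in the span of `r` and `r'`. If they are independent, the coordinate
  -- determinant is nonzero and `r` can be solved for in terms of `p` and `p'`.
  obtain ⟨α₁, α₂, hα⟩ := hmem w u₃ u₁ p hw0 hw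
  obtain ⟨β₁, β₂, hβ⟩ := hmem z u₄ u₂ p' hz0 hz
  have hD : α₁ * β₂ - α₂ * β₁ ≠ 0 := by
    intro hD
    have h1 := LinearIndependent.pair_iff.1 hl β₂ (-α₂) (by
      rw [hα, hβ]
      have : β₂ • (α₁ • r + α₂ • r') + -α₂ • (β₁ • r + β₂ • r')
        = (α₁ * β₂ - α₂ * β₁) • r := by module
      rw [this, hD, zero_smul])
    have h2 := LinearIndependent.pair_iff.1 hl β₁ (-α₁) (by
      rw [hα, hβ]
      have : β₁ • (α₁ • r + α₂ • r') + -α₁ • (β₁ • r + β₂ • r')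
        = -(α₁ * β₂ - α₂ * β₁) • r' := by module
      rw [this, hD, neg_zero, zero_smul])
    apply hp
    rw [hα, neg_eq_zero.1 h1.2, neg_eq_zero.1 h2.2]
    simp
  obtain ⟨s, s', hr⟩ : ∃ s s' : F, r = s • p + s' • p' := by
    refine ⟨(α₁ * β₂ - α₂ * β₁)⁻¹ * β₂, -((α₁ * β₂ - α₂ * β₁)⁻¹ * α₂), ?_⟩
    rw [neg_smul, mul_smul, mul_smul, ← sub_eq_add_neg, ← smul_sub, eq_inv_smul_iff₀ hD, hα, hβ]
    module
  -- Since `a - b = (u₁ - u₂) ⊗ r` splits along `p` and `p'`, moving from `a` by the `p`-component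
  -- gives a common point of the two lines.
  refine hdisj (c + u₁.smulRight r - (s • (u₁ - u₂)).smulRight p)
    ⟨-(s • (u₁ - u₂)), ?_⟩ ⟨s' • (u₁ - u₂), ?_⟩
  · ext x; simp [sub_eq_add_neg, neg_smul, -neg_add_rev]
  · ext x
    simp only [LinearMap.add_apply, LinearMap.sub_apply, LinearMap.smulRight_apply,
      LinearMap.smul_apply, smul_eq_mul]
    rw [hr]
    module

end RankOne

/-! ### Line-preserving bijections: parallelism and additivity. -/

section LinePreserving

variable {F T P : Type*} [Field F] [AddCommGroup T] [Module F T] [AddCommGroup P] [Module F P]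
  [FiniteDimensional F T]

/-- If `ψ` maps lines onto lines, then the directions of the images of parallel lines agree. -/
theorem direction_eq [Nontrivial T] {ψ : (T →ₗ[F] P) → (T →ₗ[F] P)} (hψ : Function.Injective ψ)
    (hcard : ∀ u : Dual F T, ∃ v : Dual F T, v ≠ 0 ∧ v ≠ u)
    {δ : (T →ₗ[F] P) → P → P} (hδ : ∀ f p, p ≠ 0 → δ f p ≠ 0)
    (hline : ∀ f p, p ≠ 0 → ∀ g, OnLine f p g ↔ OnLine (ψ f) (δ f p) (ψ g))
    (hsurj : Function.Surjective ψ)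
    {p : P} (hp : p ≠ 0) (f : T →ₗ[F] P) : F ∙ δ f p = F ∙ δ 0 p := by
  induction f using linearMap_rankOne_induction with
  | zero => rfl
  | step f u r ih =>
    rw [← ih]
    by_cases hon : OnLine f p (f + u.smulRight r)
    · refine span_eq_of_onLine_iff (f := ψ (f + u.smulRight r)) (f' := ψ f) (hδ _ _ hp)
        fun g hg => ?_
      obtain ⟨g, rfl⟩ := hsurj g
      rw [← hline _ _ hp, ← OnLine.congr_base hon] at hg
      exact (hline _ _ hp _).1 hg
    have hu : u ≠ 0 := by
      rintro rfl
      refine hon ⟨0, ?_⟩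
      ext; simp
    have hr : r ≠ 0 := by
      rintro rfl
      refine hon ⟨0, ?_⟩
      ext; simp
    have hrp : r - p ≠ 0 := by
      intro h
      rw [sub_eq_zero] at h
      subst h
      exact hon (onLine_add _ _ _)
    -- The centre of perspective is `f + v ⊗ r`, on the `r`-line joining the two base points; the
    -- second line through it has direction `r - p`. The conditions `v ≠ 0` and `v ≠ u` keep it
    -- apart from both base points.
    obtain ⟨v, hv, hvu⟩ := hcard u
    symm
    refine span_eq_of_perspective (c := ψ (f + v.smulRight r))
      (r := δ (f + v.smulRight r) r) (r' := δ (f + v.smulRight r) (r - p))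
      (a := ψ f) (b := ψ (f + u.smulRight r)) (a' := ψ (f + v.smulRight p))
      (b' := ψ (f + u.smulRight r + (v - u).smulRight p)) (hδ _ _ hp) (hδ _ _ hp)
      ((hline _ _ hr _).1 ⟨-v, ?_⟩) ((hline _ _ hr _).1 ⟨u - v, ?_⟩)
      ((hline _ _ hrp _).1 ⟨-v, ?_⟩) ((hline _ _ hrp _).1 ⟨u - v, ?_⟩)
      ((hline _ _ hp _).1 ⟨v, rfl⟩) ((hline _ _ hp _).1 ⟨v - u, rfl⟩)
      (fun h => ?_) (fun h => ?_) (fun g h1 h2 => ?_)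
    · ext x; simp
    · ext x; simp [sub_smul]
    · ext x; simp [smul_sub]
    · ext x; simp [sub_smul, smul_sub]; abel
    · have h1 : v.smulRight p = 0 := (left_eq_add.1 (hψ h))
      obtain ⟨x, hx⟩ := exists_dual_apply_ne_zero hv
      exact (smul_ne_zero hx hp) (by simpa using LinearMap.congr_fun h1 x)
    · have h1 : (v - u).smulRight p = 0 := (left_eq_add.1 (hψ h))
      obtain ⟨x, hx⟩ := exists_dual_apply_ne_zero (sub_ne_zero.2 hvu)
      exact (smul_ne_zero hx hp) (by simpa using LinearMap.congr_fun h1 x)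
    · obtain ⟨g, rfl⟩ := hsurj g
      rw [← hline _ _ hp] at h1 h2
      exact hon ((OnLine.congr_base h1).2 ((OnLine.congr_base h2).1 (OnLine.refl _ _)))

variable {ψ : (T →ₗ[F] P) → (T →ₗ[F] P)} {δ : P → P}

/-- If the image directions coincided, the lines through `0` in directions `p` and `q` would have
the same image line, so one would contain the other. -/
theorem span_direction_ne [Nontrivial T] (hδ : ∀ p, p ≠ 0 → δ p ≠ 0)
    (hline : ∀ f p, p ≠ 0 → ∀ g, OnLine f p g ↔ OnLine (ψ f) (δ p) (ψ g))
    {p q : P} (h : LinearIndependent F ![p, q]) : LinearIndependent F ![δ p, δ q] := by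
  have hp : p ≠ 0 := h.ne_zero 0
  have hq : q ≠ 0 := h.ne_zero 1
  refine (linearIndependent_pair_or_span_eq (hδ p hp) (hδ q hq)).resolve_right fun he => ?_
  refine not_linearIndependent_of_span_eq ?_ h
  refine span_eq_of_onLine_iff (f := (0 : T →ₗ[F] P)) (f' := 0) hp fun g hg => ?_
  rw [hline _ _ hp, OnLine.congr_dir he] at hg
  exact (hline _ _ hq _).2 hg

/-- Parallelograms with independent directions are preserved. -/
theorem map_parallelogram [Nontrivial T] (hδ : ∀ p, p ≠ 0 → δ p ≠ 0)
    (hline : ∀ f p, p ≠ 0 → ∀ g, OnLine f p g ↔ OnLine (ψ f) (δ p) (ψ g))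
    {p q : P} (h : LinearIndependent F ![p, q]) (f : T →ₗ[F] P) (u v : Dual F T) :
    ψ (f + v.smulRight q + u.smulRight p) - ψ (f + v.smulRight q) =
      ψ (f + u.smulRight p) - ψ f := by
  have hp : p ≠ 0 := h.ne_zero 0
  have hq : q ≠ 0 := h.ne_zero 1
  obtain ⟨a, ha⟩ := (hline _ _ hp _).1 (onLine_add f u p)
  obtain ⟨b, hb⟩ := (hline _ _ hq _).1 (onLine_add f v q)
  obtain ⟨a', ha'⟩ := (hline _ _ hp _).1 (onLine_add (f + v.smulRight q) u p)
  obtain ⟨b', hb'⟩ := (hline _ _ hq _).1 (onLine_add (f + u.smulRight p) v q)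
  rw [add_right_comm, ha', ha, hb] at hb'
  have key := (eq_zero_of_smulRight_eq (u := a' - a) (w := b' - b) (span_direction_ne hδ hline h)
    (by
      ext x
      have := LinearMap.congr_fun hb' x
      simp only [LinearMap.add_apply, LinearMap.smulRight_apply, LinearMap.sub_apply,
        sub_smul] at this ⊢
      rw [sub_eq_sub_iff_add_eq_add]
      rw [add_assoc, add_assoc] at this
      have := add_left_cancel this
      rw [add_comm, this, add_comm])).1
  rw [ha', ha, sub_eq_zero.1 key]
  simp

/-- The effect of a rank-one step does not depend on the base point: the base point is moved by
rank-one steps, each handled by parallelograms. -/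
theorem map_sub_translate [Nontrivial T] (hP : 1 < finrank F P) (hδ : ∀ p, p ≠ 0 → δ p ≠ 0)
    (hline : ∀ f p, p ≠ 0 → ∀ g, OnLine f p g ↔ OnLine (ψ f) (δ p) (ψ g))
    (f k : T →ₗ[F] P) (u : Dual F T) (p : P) :
    ψ (f + k + u.smulRight p) - ψ (f + k) = ψ (f + u.smulRight p) - ψ f := by
  by_cases hp : p = 0
  · subst hp
    have : u.smulRight (0 : P) = 0 := by ext; simp
    simp [this]
  have step (f : T →ₗ[F] P) (v : Dual F T) (q : P) :
      ψ (f + v.smulRight q + u.smulRight p) - ψ (f + v.smulRight q) =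
        ψ (f + u.smulRight p) - ψ f := by
    by_cases h : LinearIndependent F ![p, q]
    · exact map_parallelogram hδ hline h f u v
    · rw [LinearIndependent.pair_iff' hp] at h
      push Not at h
      obtain ⟨c, rfl⟩ := h
      -- A move parallel to `p` is replaced by two moves, along `r` and `c • p - r`, both
      -- independent of `p`.
      obtain ⟨r, hr⟩ := exists_linearIndependent_pair_of_one_lt_finrank hP hp
      have hr' : LinearIndependent F ![p, c • p - r] := by
        rw [LinearIndependent.pair_iff] at hr ⊢
        intro s t hst
        have := hr (s + t * c) (-t) (by rw [← hst]; module)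
        have ht := neg_eq_zero.1 this.2
        exact ⟨by simpa [ht] using this.1, ht⟩
      have e : f + v.smulRight (c • p) = f + v.smulRight r + v.smulRight (c • p - r) := by
        ext x; simp [smul_sub]
      rw [e, map_parallelogram hδ hline hr', map_parallelogram hδ hline hr]
  induction k using linearMap_rankOne_induction with
  | zero => simp
  | step k v q ih => rw [← add_assoc f, step, ih]

theorem map_add_of_onLine_iff [Nontrivial T] (hP : 1 < finrank F P) (hδ : ∀ p, p ≠ 0 → δ p ≠ 0)
    (hline : ∀ f p, p ≠ 0 → ∀ g, OnLine f p g ↔ OnLine (ψ f) (δ p) (ψ g)) (h0 : ψ 0 = 0)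
    (f g : T →ₗ[F] P) : ψ (f + g) = ψ f + ψ g := by
  induction g using linearMap_rankOne_induction with
  | zero => simp [h0]
  | step g u p ih =>
    have h1 := map_sub_translate hP hδ hline 0 (f + g) u p
    have h2 := map_sub_translate hP hδ hline 0 g u p
    rw [← h2, zero_add, zero_add, ih] at h1
    rw [← add_assoc f, sub_eq_iff_eq_add.1 h1]
    abel

/-- An additive map that agrees with `β` up to scalars is a multiple of `β`. -/
theorem exists_smul_eq_of_mem_span {β β' : P →+ P} (hP : 1 < finrank F P)
    (hβ : ∀ p q, LinearIndependent F ![p, q] → LinearIndependent F ![β p, β q])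
    (hmem : ∀ p, ∃ c : F, β' p = c • β p) : ∃ c : F, ∀ p, β' p = c • β p := by
  choose c hc using hmem
  -- For independent vectors, both scalars equal the scalar at `p + q`. Dependent vectors are
  -- compared through a third vector.
  have hindep {p q : P} (h : LinearIndependent F ![p, q]) : c p = c q := by
    have h1 := hc (p + q)
    rw [map_add, map_add, hc p, hc q] at h1
    have := LinearIndependent.pair_iff.1 (hβ p q h) (c p - c (p + q)) (c q - c (p + q))
      (by
        have e : (c p - c (p + q)) • β p + (c q - c (p + q)) • β q =
          c p • β p + c q • β q - c (p + q) • (β p + β q) := by module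
        rw [e, h1, sub_self])
    rw [sub_eq_zero.1 this.1, sub_eq_zero.1 this.2]
  have : Nontrivial P := nontrivial_of_finrank_pos (R := F) (by omega)
  obtain ⟨p₀, hp₀⟩ := exists_ne (0 : P)
  refine ⟨c p₀, fun p => ?_⟩
  by_cases hp : p = 0
  · simp [hp]
  by_cases h : LinearIndependent F ![p₀, p]
  · rw [hindep h, ← hc]
  · rw [LinearIndependent.pair_iff' hp₀] at h
    push Not at h
    obtain ⟨a, rfl⟩ := h
    have ha : a ≠ 0 := by rintro rfl; simp at hp
    obtain ⟨r, hr⟩ := exists_linearIndependent_pair_of_one_lt_finrank hP hp₀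
    have hr' : LinearIndependent F ![a • p₀, r] := by
      rw [LinearIndependent.pair_iff] at hr ⊢
      intro s t hst
      have := hr (s * a) t (by rw [← hst]; module)
      exact ⟨by simpa [ha] using this.1, this.2⟩
    rw [hindep hr, ← hindep hr', ← hc]

end LinePreserving

/-! ### From additivity to the form `α ⊗ β` and semilinear maps. -/

section Semilinear

variable {F T P : Type*} [Field F] [AddCommGroup T] [Module F T] [AddCommGroup P] [Module F P]
  {ψ : (T →ₗ[F] P) → (T →ₗ[F] P)} {δ : P → P}

theorem map_smulRight_of_onLine_iff (h0 : ψ 0 = 0)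
    (hline : ∀ f p, p ≠ 0 → ∀ g, OnLine f p g ↔ OnLine (ψ f) (δ p) (ψ g)) (u : Dual F T)
    {p : P} (hp : p ≠ 0) : ∃ v : Dual F T, ψ (u.smulRight p) = v.smulRight (δ p) := by
  obtain ⟨v, hv⟩ := (hline _ _ hp _).1 (onLine_add 0 u p)
  rw [zero_add, h0, zero_add] at hv
  exact ⟨v, hv⟩

theorem mem_span_of_smulRight_eq {v w : Dual F T} {p q : P} (hv : v ≠ 0)
    (h : v.smulRight p = w.smulRight q) : ∃ c : F, p = c • q := by
  obtain ⟨x, hx⟩ := exists_dual_apply_ne_zero hv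
  refine ⟨(v x)⁻¹ * w x, ?_⟩
  have := LinearMap.congr_fun h x
  simp only [LinearMap.smulRight_apply] at this
  rw [mul_smul, ← this, inv_smul_smul₀ hx]

theorem smulRight_eq_zero {v : Dual F T} {p : P} : v.smulRight p = 0 ↔ v = 0 ∨ p = 0 := by
  constructor
  · intro h
    by_contra! hc
    obtain ⟨x, hx⟩ := exists_dual_apply_ne_zero hc.1
    exact smul_ne_zero hx hc.2 (by simpa using LinearMap.congr_fun h x)
  · rintro (rfl | rfl) <;> ext <;> simp

theorem smulRight_right_injective {v : Dual F T} (hv : v ≠ 0) :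
    Function.Injective fun p : P => v.smulRight p := by
  intro p q h
  obtain ⟨x, hx⟩ := exists_dual_apply_ne_zero hv
  have := LinearMap.congr_fun h x
  simpa [hx] using this

/-- If `v` and `w` were independent, `v ⊗ a - w ⊗ b` would have rank two, while `z ⊗ d` has rank at
most one. -/
theorem exists_smul_of_sub_eq_smulRight {v w z : Dual F T} {a b d : P}
    (hl : LinearIndependent F ![a, b]) (hv : v ≠ 0)
    (h : v.smulRight a = w.smulRight b + z.smulRight d) : ∃ c : F, w = c • v := by
  obtain ⟨x, hx⟩ := exists_dual_apply_ne_zero hv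
  have h1 (y : T) : v y • a = w y • b + z y • d := by simpa using LinearMap.congr_fun h y
  refine ⟨(v x)⁻¹ * w x, LinearMap.ext fun y => ?_⟩
  have hzx : z x ≠ 0 := by
    intro hz
    have := h1 x
    rw [hz, zero_smul, add_zero] at this
    exact hx (LinearIndependent.pair_iff.1 hl (v x) (-w x) (by rw [this]; module)).1
  have h2 := LinearIndependent.pair_iff.1 hl (z x * v y - z y * v x) (z y * w x - z x * w y) (by
    have e : (z x * v y - z y * v x) • a + (z y * w x - z x * w y) • b =
      z x • (v y • a) - z y • (v x • a) + (z y * w x - z x * w y) • b := by module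
    rw [e, h1 y, h1 x]
    module)
  have e1 := h2.1
  have e2 := h2.2
  simp only [LinearMap.smul_apply, smul_eq_mul]
  apply mul_left_cancel₀ (mul_ne_zero hzx hx)
  have e : z x * v x * ((v x)⁻¹ * w x * v y) = z x * w x * v y := by field_simp
  rw [e]
  linear_combination (-(v x)) * e2 - w x * e1

/-- The maps `u ⊗ p₀` and `u ⊗ p` differ by `u ⊗ (p₀ - p)`, so their images differ by a map of rank
at most one. For independent `p₀, p` this forces the functionals of the two images to be
proportional; the other `p` are sums of two vectors independent of `p₀`. -/
theorem exists_row_map [FiniteDimensional F T] [Nontrivial T] (hP : 1 < finrank F P) (hψ : Function.Injective ψ)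
    (hδ : ∀ p, p ≠ 0 → δ p ≠ 0)
    (hline : ∀ f p, p ≠ 0 → ∀ g, OnLine f p g ↔ OnLine (ψ f) (δ p) (ψ g)) (h0 : ψ 0 = 0)
    (hadd : ∀ f g, ψ (f + g) = ψ f + ψ g) {u : Dual F T} (hu : u ≠ 0) :
    ∃ (v : Dual F T) (β : P →+ P), v ≠ 0 ∧ ∀ p, ψ (u.smulRight p) = v.smulRight (β p) := by
  have : Nontrivial P := nontrivial_of_finrank_pos (R := F) (by omega)
  obtain ⟨p₀, hp₀⟩ := exists_ne (0 : P)
  obtain ⟨v, hv⟩ := map_smulRight_of_onLine_iff h0 hline u hp₀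
  have hv0 : v ≠ 0 := by
    rintro rfl
    have : u.smulRight p₀ = 0 := hψ (by rw [hv, h0]; ext; simp)
    exact (smulRight_eq_zero.1 this).elim hu hp₀
  have hind {p : P} (hp : LinearIndependent F ![p₀, p]) :
      ∃ q, ψ (u.smulRight p) = v.smulRight q := by
    have hp0 : p ≠ 0 := hp.ne_zero 1
    obtain ⟨w, hw⟩ := map_smulRight_of_onLine_iff h0 hline u hp0
    have hd : p₀ - p ≠ 0 := by
      intro h
      rw [sub_eq_zero] at h
      exact not_linearIndependent_of_span_eq (by rw [h]) hp
    obtain ⟨z, hz⟩ := (hline (u.smulRight p) _ hd (u.smulRight p₀)).1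
      ⟨u, by ext; simp [smul_sub]⟩
    rw [hv, hw] at hz
    obtain ⟨c, rfl⟩ := exists_smul_of_sub_eq_smulRight (span_direction_ne hδ hline hp) hv0 hz
    exact ⟨c • δ p, by rw [hw]; ext; simp [smul_smul, mul_comm]⟩
  have hall (p : P) : ∃ q, ψ (u.smulRight p) = v.smulRight q := by
    by_cases h : LinearIndependent F ![p₀, p]
    · exact hind h
    · rw [LinearIndependent.pair_iff' hp₀] at h
      push Not at h
      obtain ⟨c, rfl⟩ := h
      obtain ⟨r, hr⟩ := exists_linearIndependent_pair_of_one_lt_finrank hP hp₀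
      have hr' : LinearIndependent F ![p₀, c • p₀ - r] := by
        rw [LinearIndependent.pair_iff] at hr ⊢
        intro s t hst
        have := hr (s + t * c) (-t) (by rw [← hst]; module)
        have ht := neg_eq_zero.1 this.2
        exact ⟨by simpa [ht] using this.1, ht⟩
      obtain ⟨q₁, h₁⟩ := hind hr
      obtain ⟨q₂, h₂⟩ := hind hr'
      refine ⟨q₁ + q₂, ?_⟩
      have e : u.smulRight (c • p₀) = u.smulRight r + u.smulRight (c • p₀ - r) := by
        ext x; simp [smul_sub]
      rw [e, hadd, h₁, h₂]
      ext; simp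
  choose β hβ using hall
  refine ⟨v, AddMonoidHom.mk' β fun p q => ?_, hv0, hβ⟩
  apply smulRight_right_injective hv0
  have e : u.smulRight (p + q) = u.smulRight p + u.smulRight q := by ext; simp
  change v.smulRight _ = v.smulRight _
  rw [← hβ, e, hadd, hβ, hβ]
  ext; simp

/-- An additive bijection of `Hom(T, P)` preserving the lines is of the form `α ⊗ β`. -/
theorem exists_tensor_form [FiniteDimensional F T] [Nontrivial T] (hP : 1 < finrank F P) (hψ : Function.Injective ψ)
    (hδ : ∀ p, p ≠ 0 → δ p ≠ 0)
    (hline : ∀ f p, p ≠ 0 → ∀ g, OnLine f p g ↔ OnLine (ψ f) (δ p) (ψ g)) (h0 : ψ 0 = 0)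
    (hadd : ∀ f g, ψ (f + g) = ψ f + ψ g) :
    ∃ (α : Dual F T → Dual F T) (β : P →+ P) (σ : F → F), Function.Injective β ∧
      (∀ u p, ψ (u.smulRight p) = (α u).smulRight (β p)) ∧
      ∀ c p, β (c • p) = σ c • β p := by
  obtain ⟨u₀, hu₀⟩ := exists_ne (0 : Dual F T)
  obtain ⟨v₀, β, hv₀, hβ⟩ := exists_row_map hP hψ hδ hline h0 hadd hu₀
  have hinj : Function.Injective β := by
    intro p q h
    refine smulRight_right_injective hu₀ (hψ ?_)
    rw [hβ, hβ, h]
  have hne {p : P} (hp : p ≠ 0) : β p ≠ 0 := (map_ne_zero_iff β hinj).2 hp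
  have hspan {p : P} (hp : p ≠ 0) : F ∙ β p = F ∙ δ p := by
    obtain ⟨w, hw⟩ := map_smulRight_of_onLine_iff h0 hline u₀ hp
    rw [hβ] at hw
    exact span_eq_of_smulRight_eq hv₀ (hne hp) hw
  have hind (p q : P) (h : LinearIndependent F ![p, q]) : LinearIndependent F ![β p, β q] := by
    have hp : p ≠ 0 := h.ne_zero 0
    have hq : q ≠ 0 := h.ne_zero 1
    refine (linearIndependent_pair_or_span_eq (hne hp) (hne hq)).resolve_right fun he => ?_
    rw [hspan hp, hspan hq] at he
    exact not_linearIndependent_of_span_eq he (span_direction_ne hδ hline h)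
  have hmem {u v : Dual F T} {p q : P} (hp : p ≠ 0) (hv : v ≠ 0)
      (h : ψ (u.smulRight p) = v.smulRight q) : ∃ c : F, q = c • β p := by
    obtain ⟨w, hw⟩ := map_smulRight_of_onLine_iff h0 hline u hp
    obtain ⟨c, rfl⟩ := mem_span_of_smulRight_eq hv (h.symm.trans hw)
    have : δ p ∈ F ∙ β p := hspan hp ▸ mem_span_singleton_self _
    obtain ⟨d, hd⟩ := mem_span_singleton.1 this
    exact ⟨c * d, by rw [mul_smul, hd]⟩
  have hα (u : Dual F T) : ∃ v : Dual F T, ∀ p, ψ (u.smulRight p) = v.smulRight (β p) := by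
    by_cases hu : u = 0
    · subst hu
      refine ⟨0, fun p => ?_⟩
      rw [smulRight_eq_zero.2 (Or.inl rfl), h0, smulRight_eq_zero.2 (Or.inl rfl)]
    · obtain ⟨v, β', hv, hβ'⟩ := exists_row_map hP hψ hδ hline h0 hadd hu
      -- The maps `β'` and `β` both send `p` into the span of `δ p`, so they are proportional and
      -- the factor can be absorbed into the functional.
      obtain ⟨c, hc⟩ := exists_smul_eq_of_mem_span (β' := β') hP hind fun p => by
        by_cases hp : p = 0
        · exact ⟨0, by simp [hp]⟩
        · exact hmem hp hv (hβ' p)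
      refine ⟨c • v, fun p => ?_⟩
      rw [hβ', hc]
      ext; simp [smul_smul, mul_comm]
  have hσ (c : F) : ∃ s : F, ∀ p, β (c • p) = s • β p := by
    refine exists_smul_eq_of_mem_span (β' := β.comp (DistribSMul.toAddMonoidHom P c)) hP hind
      fun p => ?_
    by_cases hp : p = 0
    · exact ⟨0, by simp [hp]⟩
    · refine hmem (u := c • u₀) hp hv₀ ?_
      -- Moving the scalar across the tensor sign shows that `β (c • p)` still lies in the span of
      -- `β p`.
      have e : (c • u₀).smulRight p = u₀.smulRight (c • p) := by
        ext; simp [smul_smul, mul_comm]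
      rw [e, hβ]
      rfl
  choose α hα using hα
  choose σ hσ using hσ
  exact ⟨α, β, σ, hinj, hα, hσ⟩

/-- A bijection of `Hom(T, P)` preserving the lines is, up to a translation, induced by
semilinear maps of `T` and `P` with the same companion automorphism. -/
theorem exists_semilinear_of_onLine_iff [Finite F] [FiniteDimensional F T] [Nontrivial T] (hP : 1 < finrank F P)
    (hcard : ∀ u : Dual F T, ∃ v : Dual F T, v ≠ 0 ∧ v ≠ u) (hψ : Function.Bijective ψ)
    (hline : ∀ f p, p ≠ 0 → ∃ p', p' ≠ 0 ∧ ∀ g, OnLine f p g ↔ OnLine (ψ f) p' (ψ g)) :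
    ∃ (σ : F ≃+* F) (β : P →+ P) (γ : T →+ T), Function.Injective β ∧ Function.Injective γ ∧
      (∀ (c : F) p, β (c • p) = σ c • β p) ∧ (∀ (c : F) x, γ (c • x) = σ c • γ x) ∧
      ∀ f x, ψ f (γ x) = ψ 0 (γ x) + β (f x) := by
  choose! δ hδ hδl using hline
  have hdir {p : P} (hp : p ≠ 0) (f : T →ₗ[F] P) :=
    direction_eq hψ.1 hcard hδ hδl hψ.2 hp f
  set φ : (T →ₗ[F] P) → (T →ₗ[F] P) := fun f => ψ f - ψ 0 with hφ
  have hφinj : Function.Injective φ := fun f g h => hψ.1 (sub_left_injective h)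
  have hφ0 : φ 0 = 0 := sub_self _
  have hφl : ∀ f p, p ≠ 0 → ∀ g, OnLine f p g ↔ OnLine (φ f) (δ 0 p) (φ g) := by
    intro f p hp g
    rw [hδl f p hp, OnLine.congr_dir (hdir hp f), onLine_iff_sub_mem, onLine_iff_sub_mem]
    simp [hφ]
  have hδ0 : ∀ p, p ≠ 0 → δ 0 p ≠ 0 := hδ 0
  have hadd := map_add_of_onLine_iff hP hδ0 hφl hφ0
  obtain ⟨α, β, σ, hβ, hα, hσ⟩ := exists_tensor_form hP hφinj hδ0 hφl hφ0 hadd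
  have : Nontrivial P := nontrivial_of_finrank_pos (R := F) (by omega)
  obtain ⟨p₀, hp₀⟩ := exists_ne (0 : P)
  have hb₀ : β p₀ ≠ 0 := (map_ne_zero_iff β hβ).2 hp₀
  have hcancel {a b : F} (h : a • β p₀ = b • β p₀) : a = b := smul_left_injective F hb₀ h
  let σ' : F →+* F :=
    { toFun := σ
      map_one' := hcancel (by rw [← hσ, one_smul, one_smul])
      map_mul' := fun a b => hcancel (by rw [← hσ, mul_smul, hσ, hσ, mul_smul])
      map_zero' := hcancel (by rw [← hσ, zero_smul, zero_smul, map_zero])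
      map_add' := fun a b => hcancel (by rw [← hσ, add_smul, map_add, hσ, hσ, add_smul]) }
  let s : F ≃+* F := RingEquiv.ofBijective σ' (Finite.injective_iff_bijective.1 σ'.injective)
  have hs (c : F) (p : P) : β (c • p) = s c • β p := hσ c p
  have hαadd (u v : Dual F T) : α (u + v) = α u + α v := by
    ext x
    apply hcancel
    have e : (u + v).smulRight p₀ = u.smulRight p₀ + v.smulRight p₀ := by
      ext; simp [add_smul]
    have := hadd (u.smulRight p₀) (v.smulRight p₀)
    rw [← e, hα, hα, hα] at this
    simpa [add_smul] using LinearMap.congr_fun this x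
  have hαsmul (c : F) (u : Dual F T) : α (c • u) = s c • α u := by
    ext x
    apply hcancel
    have e : (c • u).smulRight p₀ = u.smulRight (c • p₀) := by
      ext; simp [smul_smul, mul_comm]
    have := hα (c • u) p₀
    rw [e, hα, hs] at this
    simpa [smul_smul, mul_comm] using (LinearMap.congr_fun this x).symm
  have hαinj : Function.Injective α := by
    intro u v h
    have h1 : φ (u.smulRight p₀) = φ (v.smulRight p₀) := by rw [hα, hα, h]
    ext x
    exact smul_left_injective F hp₀ (LinearMap.congr_fun (hφinj h1) x)
  have : Finite (Dual F T) := Module.finite_of_finite F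
  let A : Dual F T ≃ Dual F T := Equiv.ofBijective α (Finite.injective_iff_bijective.1 hαinj)
  have hA (u : Dual F T) : A u = α u := rfl
  have hAadd (u v : Dual F T) : A.symm (u + v) = A.symm u + A.symm v := by
    apply A.injective
    rw [hA (_ + _), hαadd, ← hA, ← hA]
    simp
  have hAsmul (c : F) (u : Dual F T) : A.symm (c • u) = s.symm c • A.symm u := by
    apply A.injective
    rw [hA (_ • _), hαsmul, ← hA]
    simp
  -- By reflexivity, `γ x` is the vector on which `α u` takes the value `s (u x)` for every `u`;
  -- that is, `γ` is the `s`-twisted inverse transpose of `α`. Twisting by `s` makes `ev x` linear.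
  let ev (x : T) : Dual F (Dual F T) :=
    { toFun := fun φ => s (A.symm φ x)
      map_add' := fun u v => by rw [hAadd]; simp
      map_smul' := fun c u => by rw [hAsmul]; simp }
  have hev (x : T) (u : Dual F T) : α u ((evalEquiv F T).symm (ev x)) = s (u x) := by
    rw [apply_evalEquiv_symm_apply]
    change s (A.symm (A u) x) = _
    simp
  let γ : T →+ T := AddMonoidHom.mk' (fun x => (evalEquiv F T).symm (ev x)) fun x y => by
    rw [← map_add]
    congr 1
    ext u
    change s _ = s _ + s _
    simp
  have hγ (x : T) (u : Dual F T) : α u (γ x) = s (u x) := hev x u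
  refine ⟨s, β, γ, hβ, ?_, hs, fun c x => ?_, fun f x => ?_⟩
  · rw [injective_iff_map_eq_zero]
    intro x hx
    rw [← forall_dual_apply_eq_zero_iff F]
    intro u
    have := hγ x u
    rw [hx, map_zero] at this
    simpa using this.symm
  · change (evalEquiv F T).symm (ev (c • x)) = s c • (evalEquiv F T).symm (ev x)
    rw [← map_smul]
    congr 1
    ext u
    change s _ = s c * s _
    simp
  · have key : φ f (γ x) = β (f x) := by
      induction f using linearMap_rankOne_induction with
      | zero => simp [hφ0]
      | step f u p ih =>
        rw [hadd, LinearMap.add_apply, ih, hα]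
        simp [hγ, hs]
    rw [← key]
    simp [hφ]

/-- The hypothesis on the size of the dual space holds outside the case of two elements. -/
theorem exists_dual_ne_zero_ne [Finite F] [FiniteDimensional F T] (ht : 1 ≤ finrank F T)
    (htq : 2 ≤ finrank F T ∨ 3 ≤ Nat.card F) (u : Dual F T) : ∃ v : Dual F T, v ≠ 0 ∧ v ≠ u := by
  have : Finite (Dual F T) := Module.finite_of_finite F
  have hq : 2 ≤ Nat.card F := Finite.one_lt_card
  have hc : 3 ≤ Nat.card (Dual F T) := by
    rw [Module.natCard_eq_pow_finrank (K := F), Subspace.dual_finrank_eq]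
    rcases htq with h | h
    · calc 3 ≤ 2 ^ 2 := by norm_num
        _ ≤ Nat.card F ^ 2 := Nat.pow_le_pow_left hq 2
        _ ≤ _ := Nat.pow_le_pow_right (by omega) h
    · calc 3 ≤ Nat.card F ^ 1 := by simpa using h
        _ ≤ _ := Nat.pow_le_pow_right (by omega) ht
  by_contra! h
  have hsub : (Set.univ : Set (Dual F T)) ⊆ {0, u} := fun v _ => by
    by_cases hv : v = 0
    · simp [hv]
    · simp [h v hv]
  have := Set.ncard_le_ncard hsub
  have h2 := Set.ncard_insert_le (0 : Dual F T) {u}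
  rw [Set.ncard_univ] at this
  rw [Set.ncard_singleton] at h2
  omega

end Semilinear

/-! ### The action of the stabiliser of `π` on the geometry. -/

section Collineations

variable {F V : Type*} [Field F] [AddCommGroup V] [Module F V]

theorem PGammaL.smul_le_smul_iff (g : PGammaL F V) {W W' : Submodule F V} :
    g • W ≤ g • W' ↔ W ≤ W' := by
  induction g using QuotientGroup.induction_on with
  | H g =>
    rw [PGammaL.mk_smul, PGammaL.mk_smul]
    constructor
    · intro h v hv
      obtain ⟨w, hw, e⟩ := h ⟨v, hv, rfl⟩
      rwa [← g.1.injective e]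
    · rintro h _ ⟨w, hw, rfl⟩
      exact ⟨w, h hw, rfl⟩

theorem PGammaL.smul_inf (g : PGammaL F V) (W W' : Submodule F V) :
    g • (W ⊓ W') = g • W ⊓ g • W' := by
  induction g using QuotientGroup.induction_on with
  | H g =>
    simp only [PGammaL.mk_smul]
    ext v
    constructor
    · rintro ⟨w, hw, rfl⟩
      exact ⟨⟨w, hw.1, rfl⟩, ⟨w, hw.2, rfl⟩⟩
    · rintro ⟨⟨w, hw, rfl⟩, ⟨w', hw', e⟩⟩
      rw [g.1.injective e] at hw'
      exact ⟨w, ⟨hw, hw'⟩, rfl⟩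

/-- Over a finite field the dimension can be read off from the cardinality, which any bijection
preserves. -/
theorem PGammaL.finrank_smul [Finite F] [FiniteDimensional F V] (g : PGammaL F V)
    (W : Submodule F V) : finrank F (g • W : Submodule F V) = finrank F W := by
  induction g using QuotientGroup.induction_on with
  | H g =>
    rw [PGammaL.mk_smul]
    have h : Nat.card (GammaL.mapSubspace g W) = Nat.card W :=
      (Nat.card_congr (g.1.image (W : Set V))).symm
    rw [Module.natCard_eq_pow_finrank (K := F) (V := GammaL.mapSubspace g W),
      Module.natCard_eq_pow_finrank (K := F) (V := W)] at h
    exact Nat.pow_right_injective (Finite.one_lt_card (α := F)) h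

theorem PGammaL.smul_bot (g : PGammaL F V) : g • (⊥ : Submodule F V) = ⊥ := by
  rw [eq_bot_iff, ← inv_inv g, ← PGammaL.smul_le_smul_iff g⁻¹, inv_inv, inv_smul_smul]
  exact bot_le

theorem IsInducedBy.unique {π : Submodule F V} {t : ℕ} {ψ ψ' : (geometryX π t).Aut} {g : PGammaL F V}
    (h : IsInducedBy ψ g) (h' : IsInducedBy ψ' g) : ψ = ψ' :=
  Subtype.ext (Prod.ext
    (Equiv.ext fun A => Subtype.ext ((h.1 A).trans (h'.1 A).symm))
    (Equiv.ext fun A => Subtype.ext ((h.2 A).trans (h'.2 A).symm)))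

variable [Finite F] [FiniteDimensional F V] {π : Submodule F V} {t : ℕ}

/-- The image of a point of the geometry under a collineation that stabilises `π`. -/
def stabilizerMapPoint (g : MulAction.stabilizer (PGammaL F V) π) (A : (geometryX π t).Point) :
    (geometryX π t).Point :=
  ⟨g.1 • A.1, by rw [PGammaL.finrank_smul]; exact A.2.1, by
    have h : g.1 • A.1 ⊓ π = g.1 • (A.1 ⊓ π) := by
      rw [PGammaL.smul_inf, MulAction.mem_stabilizer_iff.1 g.2]
    rw [h, A.2.2, PGammaL.smul_bot]⟩

/-- The image of a line of the geometry under a collineation that stabilises `π`. -/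
def stabilizerMapLine (g : MulAction.stabilizer (PGammaL F V) π) (L : (geometryX π t).Line) :
    (geometryX π t).Line :=
  ⟨g.1 • L.1, by rw [PGammaL.finrank_smul]; exact L.2.1, by
    have h : g.1 • L.1 ⊓ π = g.1 • (L.1 ⊓ π) := by
      rw [PGammaL.smul_inf, MulAction.mem_stabilizer_iff.1 g.2]
    rw [h, PGammaL.finrank_smul]
    exact L.2.2⟩

variable (π t) in
/-- The action of the stabiliser of `π` on the geometry. -/
def stabilizerToAut : MulAction.stabilizer (PGammaL F V) π →* (geometryX π t).Aut :=
  MonoidHom.mk'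
    (fun g => ⟨(
      { toFun := stabilizerMapPoint g
        invFun := stabilizerMapPoint g⁻¹
        left_inv := fun A => Subtype.ext (inv_smul_smul g.1 A.1)
        right_inv := fun A => Subtype.ext (smul_inv_smul g.1 A.1) },
      { toFun := stabilizerMapLine g
        invFun := stabilizerMapLine g⁻¹
        left_inv := fun A => Subtype.ext (inv_smul_smul g.1 A.1)
        right_inv := fun A => Subtype.ext (smul_inv_smul g.1 A.1) }),
      fun _ _ => PGammaL.smul_le_smul_iff g.1⟩)
    fun g h => Subtype.ext (Prod.ext
      (Equiv.ext fun A => Subtype.ext (mul_smul g.1 h.1 A.1))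
      (Equiv.ext fun A => Subtype.ext (mul_smul g.1 h.1 A.1)))

theorem stabilizerToAut_isInducedBy (g : MulAction.stabilizer (PGammaL F V) π) :
    IsInducedBy (stabilizerToAut π t g) g.1 :=
  ⟨fun _ => rfl, fun _ => rfl⟩

end Collineations

/-! ### Points of the geometry as graphs of linear maps. -/

section Graph

variable {F V : Type*} [Field F] [AddCommGroup V] [Module F V] {T π : Submodule F V}

/-- The subspace `{x + f x | x ∈ T}`. -/
def graphSubspace (f : T →ₗ[F] π) : Submodule F V :=
  LinearMap.range (T.subtype + π.subtype ∘ₗ f)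

theorem mem_graphSubspace {f : T →ₗ[F] π} {v : V} :
    v ∈ graphSubspace f ↔ ∃ x : T, (x : V) + f x = v := Iff.rfl

theorem eq_of_add_eq_add (hc : IsCompl T π) {x y : T} {p q : π} (h : (x : V) + p = y + q) :
    x = y ∧ p = q := by
  have h1 : ((x - y : T) : V) = ((q - p : π) : V) := by
    push_cast
    rw [sub_eq_sub_iff_add_eq_add, h, add_comm]
  have h2 : ((x - y : T) : V) = 0 :=
    disjoint_def.1 hc.disjoint _ (x - y).2 (h1 ▸ (q - p).2)
  have h3 : ((q - p : π) : V) = 0 := h1 ▸ h2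
  rw [ZeroMemClass.coe_eq_zero, sub_eq_zero] at h2 h3
  exact ⟨h2, h3.symm⟩

theorem graphSubspace_inf (hc : IsCompl T π) (f : T →ₗ[F] π) : graphSubspace f ⊓ π = ⊥ := by
  rw [eq_bot_iff]
  rintro _ ⟨⟨x, rfl⟩, hx⟩
  have := eq_of_add_eq_add hc (x := x) (y := 0) (p := f x) (q := ⟨_, hx⟩) (by simp)
  simp [this.1]

theorem finrank_graphSubspace (hc : IsCompl T π) (f : T →ₗ[F] π) :
    finrank F (graphSubspace f) = finrank F T := by
  refine LinearMap.finrank_range_of_inj fun x y h => ?_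
  exact (eq_of_add_eq_add hc (p := f x) (q := f y) h).1

theorem graphSubspace_le_sup_iff (hc : IsCompl T π) {f g : T →ₗ[F] π} {p : π} :
    graphSubspace g ≤ graphSubspace f ⊔ F ∙ (p : V) ↔ OnLine f p g := by
  rw [onLine_iff_sub_mem]
  constructor
  · intro h x
    obtain ⟨_, ⟨y, rfl⟩, _, hq, e⟩ := mem_sup.1 (h (mem_graphSubspace.2 ⟨x, rfl⟩))
    obtain ⟨c, rfl⟩ := mem_span_singleton.1 hq
    have := eq_of_add_eq_add hc (x := y) (y := x) (p := f y + c • p) (q := g x) (by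
      rw [← e]; simp [add_assoc])
    rw [← this.2, this.1]
    exact mem_span_singleton.2 ⟨c, by simp⟩
  · rintro h _ ⟨x, rfl⟩
    obtain ⟨c, hcp⟩ := mem_span_singleton.1 (h x)
    refine mem_sup.2 ⟨_, mem_graphSubspace.2 ⟨x, rfl⟩, c • p, mem_span_singleton.2 ⟨c, rfl⟩, ?_⟩
    have := congrArg Subtype.val hcp
    push_cast at this
    rw [this]
    simp

theorem graphSubspace_injective (hc : IsCompl T π) :
    Function.Injective (graphSubspace : (T →ₗ[F] π) → Submodule F V) := by
  intro f g h
  ext x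
  obtain ⟨y, hy⟩ := mem_graphSubspace.1 (h ▸ mem_graphSubspace.2 ⟨x, rfl⟩ :
    (x : V) + f x ∈ graphSubspace g)
  obtain ⟨rfl, h2⟩ := eq_of_add_eq_add hc hy
  rw [h2]

theorem exists_graphSubspace_eq [FiniteDimensional F V] (hc : IsCompl T π) {W : Submodule F V}
    (hW : finrank F W = finrank F T) (hWπ : W ⊓ π = ⊥) : ∃ f : T →ₗ[F] π, graphSubspace f = W := by
  have hd : Disjoint π W := (disjoint_iff.2 hWπ).symm
  have hs : π ⊔ W = ⊤ := by
    apply eq_top_of_finrank_eq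
    have h1 := finrank_sup_add_finrank_inf_eq π W
    have h2 := finrank_sup_add_finrank_inf_eq T π
    rw [hd.eq_bot, finrank_bot] at h1
    rw [hc.disjoint.eq_bot, finrank_bot, hc.sup_eq_top, finrank_top] at h2
    omega
  have hcW : IsCompl π W := ⟨hd, codisjoint_iff.2 hs⟩
  -- Subtracting from `x` its projection to `π` along `W` leaves an element of `W`.
  let f : T →ₗ[F] π := -(projectionOnto π W hcW) ∘ₗ T.subtype
  refine ⟨f, eq_of_le_of_finrank_eq ?_ ((finrank_graphSubspace hc f).trans hW.symm)⟩
  rintro _ ⟨x, rfl⟩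
  have : projectionOnto π W hcW ((x : V) + f x) = 0 := by
    rw [map_add, projectionOnto_apply_left]
    simp [f]
  exact (projectionOnto_apply_eq_zero_iff hcW).1 this

theorem graphSubspace_sup_span_inf (hc : IsCompl T π) (f : T →ₗ[F] π) {p : π} :
    (graphSubspace f ⊔ F ∙ (p : V)) ⊓ π = F ∙ (p : V) := by
  have hp : F ∙ (p : V) ≤ π := (span_singleton_le_iff_mem _ _).2 p.2
  rw [sup_comm, sup_inf_assoc_of_le _ hp, graphSubspace_inf hc, sup_bot_eq]

theorem finrank_graphSubspace_sup_span [FiniteDimensional F V] (hc : IsCompl T π)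
    (f : T →ₗ[F] π) {p : π} (hp : p ≠ 0) :
    finrank F (graphSubspace f ⊔ F ∙ (p : V) : Submodule F V) = finrank F T + 1 := by
  have hp' : F ∙ (p : V) ≤ π := (span_singleton_le_iff_mem _ _).2 p.2
  have h := finrank_sup_add_finrank_inf_eq (graphSubspace f) (F ∙ (p : V))
  have hd : graphSubspace f ⊓ F ∙ (p : V) = ⊥ :=
    eq_bot_iff.2 ((inf_le_inf_left _ hp').trans (graphSubspace_inf hc f).le)
  rw [hd, finrank_bot, add_zero, finrank_graphSubspace hc,
    finrank_span_singleton (by simpa using hp)] at h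
  exact h

theorem exists_eq_graphSubspace_sup_span [FiniteDimensional F V] (hc : IsCompl T π)
    {L : Submodule F V} (hL : finrank F L = finrank F T + 1)
    (hLπ : finrank F (L ⊓ π : Submodule F V) = 1) {f : T →ₗ[F] π} (hf : graphSubspace f ≤ L) :
    ∃ p : π, p ≠ 0 ∧ L = graphSubspace f ⊔ F ∙ (p : V) := by
  obtain ⟨⟨v, hv⟩, hv0, -⟩ := finrank_eq_one_iff'.1 hLπ
  have hp : (⟨v, hv.2⟩ : π) ≠ 0 := fun h =>
    hv0 (Subtype.ext (congrArg (fun q : π => (q : V)) h))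
  refine ⟨⟨v, hv.2⟩, hp, (eq_of_le_of_finrank_eq ?_ ?_).symm⟩
  · exact sup_le hf ((span_singleton_le_iff_mem _ _).2 hv.1)
  · rw [finrank_graphSubspace_sup_span hc f hp, hL]

/-- Every line carries a point: a complement of `L ⊓ π` inside `L`. -/
theorem exists_graphSubspace_le [FiniteDimensional F V] (hc : IsCompl T π)
    {L : Submodule F V} (hL : finrank F L = finrank F T + 1)
    (hLπ : finrank F (L ⊓ π : Submodule F V) = 1) : ∃ f : T →ₗ[F] π, graphSubspace f ≤ L := by
  obtain ⟨W, hW⟩ := Submodule.exists_isCompl (comap L.subtype π)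
  have hmap : map L.subtype (comap L.subtype π) = L ⊓ π := map_comap_subtype _ _
  have h1 : finrank F (comap L.subtype π) = 1 := by
    rw [← hLπ, ← hmap, finrank_map_subtype_eq]
  have h2 := finrank_sup_add_finrank_inf_eq (comap L.subtype π) W
  rw [hW.sup_eq_top, hW.inf_eq_bot, finrank_top, finrank_bot] at h2
  obtain ⟨f, hf⟩ := exists_graphSubspace_eq hc (W := map L.subtype W)
    (by rw [finrank_map_subtype_eq]; omega) (by
      rw [eq_bot_iff]
      rintro _ ⟨⟨w, hw, rfl⟩, hπ⟩
      have : w ∈ comap L.subtype π ⊓ W := ⟨hπ, hw⟩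
      rw [hW.inf_eq_bot, mem_bot] at this
      simp [this])
  exact ⟨f, hf ▸ map_subtype_le _ _⟩

theorem mem_scalars_of_fix_graphSubspace (hc : IsCompl T π) (hT : T ≠ ⊥) (hπ0 : π ≠ ⊥)
    {g : GammaL F V} (hπ : GammaL.mapSubspace g π = π)
    (hfix : ∀ f : T →ₗ[F] π, GammaL.mapSubspace g (graphSubspace f) = graphSubspace f) :
    g ∈ GammaL.scalars F V := by
  have hgπ (p : π) : g.1 p ∈ π :=
    hπ.le ⟨p, p.2, rfl⟩
  have hgT (x : T) : g.1 x ∈ T := by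
    obtain ⟨y, hy⟩ := mem_graphSubspace.1 (hfix 0 ▸ ⟨x, ⟨x, by simp⟩, rfl⟩ :
      g.1 x ∈ graphSubspace (0 : T →ₗ[F] π))
    rw [← hy]
    simp
  -- Invariance of all graphs means that `g` commutes with every `f`. Rank-one `f` then show that
  -- `g` is multiplication by a single `c`, first on `π` and then on `T`.
  have key (f : T →ₗ[F] π) (x : T) : g.1 (f x) = f ⟨g.1 x, hgT x⟩ := by
    obtain ⟨y, hy⟩ := mem_graphSubspace.1 (hfix f ▸ ⟨(x : V) + f x, ⟨x, rfl⟩, rfl⟩ :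
      g.1 ((x : V) + f x) ∈ graphSubspace f)
    rw [g.2.1] at hy
    obtain ⟨rfl, h2⟩ := eq_of_add_eq_add hc (y := ⟨g.1 x, hgT x⟩) (q := ⟨_, hgπ (f x)⟩) hy
    exact (congrArg Subtype.val h2).symm
  obtain ⟨x₀, hx₀T, hx₀⟩ := exists_mem_ne_zero_of_ne_bot hT
  obtain ⟨u₀, hu₀⟩ := Projective.exists_dual_eq_one F (x := (⟨x₀, hx₀T⟩ : T)) (by simpa using hx₀)
  obtain ⟨p₀, hp₀π, hp₀⟩ := exists_mem_ne_zero_of_ne_bot hπ0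
  set c := u₀ ⟨g.1 x₀, hgT ⟨x₀, hx₀T⟩⟩ with hcdef
  have hπc (p : π) : g.1 p = c • (p : V) := by
    have := key (u₀.smulRight p) ⟨x₀, hx₀T⟩
    simpa [hu₀] using this
  have hTc (x : T) : g.1 x = c • (x : V) := by
    have h1 : (⟨g.1 x, hgT x⟩ : T) - c • x = 0 := by
      rw [← forall_dual_apply_eq_zero_iff F]
      intro u
      have := key (u.smulRight ⟨p₀, hp₀π⟩) x
      rw [hπc] at this
      simp only [LinearMap.smulRight_apply, coe_smul, smul_smul] at this
      rw [map_sub, map_smul, smul_eq_mul, sub_eq_zero]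
      exact (smul_left_injective F hp₀ this).symm
    exact congrArg Subtype.val (sub_eq_zero.1 h1)
  refine ⟨c, ?_, fun v => ?_⟩
  · intro h
    have h1 := hπc ⟨p₀, hp₀π⟩
    have h2 : g.1 0 = 0 := by simpa using g.2.1 0 0
    rw [h, zero_smul, ← h2] at h1
    exact hp₀ (g.1.injective h1)
  · obtain ⟨x, hx, p, hp, rfl⟩ := mem_sup.1 (hc.sup_eq_top ▸ mem_top : v ∈ T ⊔ π)
    rw [g.2.1, hTc ⟨x, hx⟩, hπc ⟨p, hp⟩, smul_add]

end Graph

/-! ### Gluing, and the isomorphism of groups. -/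

section Main

variable {F V : Type*} [Field F] [AddCommGroup V] [Module F V]

/-- Semilinear bijections of two complementary subspaces, together with a translation, glue to a
semilinear bijection of the whole space. -/
theorem exists_gammaL_of_isCompl [Finite V] {T π : Submodule F V} (hc : IsCompl T π)
    (σ : F ≃+* F) (β : π →+ π) (γ : T →+ T) (f₀ : T →ₗ[F] π) (hβ : Function.Injective β)
    (hγ : Function.Injective γ) (hβσ : ∀ (c : F) p, β (c • p) = σ c • β p)
    (hγσ : ∀ (c : F) x, γ (c • x) = σ c • γ x) :
    ∃ g : GammaL F V, ∀ (x : T) (p : π), g.1 (x + p) = γ x + (f₀ (γ x) + β p : π) := by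
  let e := prodEquivOfIsCompl T π hc
  let G : V → V := fun v => (γ (e.symm v).1 : V) + (f₀ (γ (e.symm v).1) + β (e.symm v).2 : π)
  have hG : Function.Injective G := by
    intro v w h
    obtain ⟨h1, h2⟩ := eq_of_add_eq_add hc h
    rw [h1] at h2
    exact e.symm.injective (Prod.ext (hγ h1) (hβ (add_left_cancel h2)))
  refine ⟨⟨Equiv.ofBijective G (Finite.injective_iff_bijective.1 hG), fun v w => ?_, σ,
    fun c v => ?_⟩, fun x p => ?_⟩
  · change G (v + w) = G v + G w
    simp only [G, map_add, Prod.fst_add, Prod.snd_add, coe_add]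
    abel
  · change G (c • v) = σ c • G v
    simp only [G, map_smul, Prod.smul_fst, Prod.smul_snd, hγσ, hβσ, coe_add, coe_smul, smul_add]
  · change G _ = _
    have : e.symm (x + p) = (x, p) := e.symm_apply_eq.2 rfl
    simp only [G, this]

theorem exists_collineation [Finite F] (n t : ℕ) (hn : 1 ≤ n) (ht : 1 ≤ t)
    (htq : 2 ≤ t ∨ 3 ≤ Nat.card F) (hV : finrank F V = n + t + 1)
    (π : Submodule F V) (hπ : finrank F π = n + 1) (ψ : (geometryX π t).Aut) :
    ∃ g : PGammaL F V, g • π = π ∧ IsInducedBy ψ g := by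
  have : FiniteDimensional F V := FiniteDimensional.of_finrank_pos (by omega)
  have : Finite V := Module.finite_of_finite F
  obtain ⟨T, hT⟩ := Submodule.exists_isCompl π
  have hc : IsCompl T π := hT.symm
  have htT : finrank F T = t := by
    have := finrank_sup_add_finrank_inf_eq T π
    rw [hc.sup_eq_top, hc.inf_eq_bot, finrank_top, finrank_bot] at this
    omega
  have : Nontrivial T := nontrivial_of_finrank_pos (R := F) (by omega)
  let Q : (T →ₗ[F] π) → (geometryX π t).Point := fun f =>
    ⟨graphSubspace f, (finrank_graphSubspace hc f).trans htT, graphSubspace_inf hc f⟩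
  have hQ : Function.Bijective Q := by
    refine ⟨fun f g h => graphSubspace_injective hc (congrArg Subtype.val h), fun A => ?_⟩
    obtain ⟨f, hf⟩ := exists_graphSubspace_eq hc (A.2.1.trans htT.symm) A.2.2
    exact ⟨f, Subtype.ext hf⟩
  let E := Equiv.ofBijective Q hQ
  let φ : (T →ₗ[F] π) ≃ (T →ₗ[F] π) := (E.trans ψ.1.1).trans E.symm
  have hφ (f : T →ₗ[F] π) : (ψ.1.1 (Q f)).1 = graphSubspace (φ f) :=
    congrArg Subtype.val (E.apply_symm_apply (ψ.1.1 (Q f))).symm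
  have hline (f : T →ₗ[F] π) (p : π) (hp : p ≠ 0) :
      ∃ p', p' ≠ 0 ∧ ∀ g, OnLine f p g ↔ OnLine (φ f) p' (φ g) := by
    let L : (geometryX π t).Line := ⟨graphSubspace f ⊔ F ∙ (p : V),
      by rw [finrank_graphSubspace_sup_span hc f hp, htT], by
        rw [graphSubspace_sup_span_inf hc]
        exact finrank_span_singleton (by simpa using hp)⟩
    have hL (g : T →ₗ[F] π) : OnLine f p g ↔ graphSubspace (φ g) ≤ (ψ.1.2 L).1 := by
      rw [← graphSubspace_le_sup_iff hc, ← hφ]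
      exact (ψ.2 (Q g) L).symm
    obtain ⟨p', hp', e⟩ := exists_eq_graphSubspace_sup_span hc
      ((ψ.1.2 L).2.1.trans (by rw [htT])) (ψ.1.2 L).2.2 ((hL f).1 (OnLine.refl f p))
    refine ⟨p', hp', fun g => ?_⟩
    rw [hL, e, graphSubspace_le_sup_iff hc]
  obtain ⟨σ, β, γ, hβ, hγ, hβσ, hγσ, hform⟩ := exists_semilinear_of_onLine_iff (by omega)
    (exists_dual_ne_zero_ne (by omega) (by rwa [htT])) φ.bijective hline
  obtain ⟨g, hg⟩ := exists_gammaL_of_isCompl hc σ β γ (φ 0) hβ hγ hβσ hγσ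
  have hgπ : (QuotientGroup.mk g : PGammaL F V) • π = π := by
    refine eq_of_le_of_finrank_eq ?_ (PGammaL.finrank_smul _ _)
    rintro _ ⟨p, hp, rfl⟩
    have := hg 0 ⟨p, hp⟩
    simp only [map_zero, coe_zero, zero_add] at this
    rw [this]
    exact (β ⟨p, hp⟩).2
  have hpt (f : T →ₗ[F] π) :
      (QuotientGroup.mk g : PGammaL F V) • graphSubspace f = graphSubspace (φ f) := by
    refine eq_of_le_of_finrank_eq ?_ ?_
    · rintro _ ⟨_, ⟨x, rfl⟩, rfl⟩
      -- The vector `x + f x` goes to `γ x + φ 0 (γ x) + β (f x)`, which is `γ x + φ f (γ x)`.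
      refine mem_graphSubspace.2 ⟨γ x, ?_⟩
      rw [hform]
      exact (hg x (f x)).symm
    · rw [PGammaL.finrank_smul, finrank_graphSubspace hc, finrank_graphSubspace hc]
  refine ⟨QuotientGroup.mk g, hgπ, fun A => ?_, fun L => ?_⟩
  · obtain ⟨f, rfl⟩ := hQ.2 A
    exact (hφ f).trans (hpt f).symm
  · obtain ⟨f, hf⟩ := exists_graphSubspace_le hc (L.2.1.trans (by rw [htT])) L.2.2
    obtain ⟨p, hp, e⟩ := exists_eq_graphSubspace_sup_span hc
      (L.2.1.trans (by rw [htT])) L.2.2 hf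
    obtain ⟨u, hu⟩ := exists_ne (0 : Dual F T)
    set f' := f + u.smulRight p with hf'
    have hne : φ f ≠ φ f' := fun h => by
      have h1 := left_eq_add.1 (φ.injective h)
      exact (smulRight_eq_zero.1 h1).elim hu hp
    have hfL : graphSubspace f' ≤ L.1 := by
      rw [e, graphSubspace_le_sup_iff hc]
      exact onLine_add f u p
    have h1 : graphSubspace (φ f) ≤ (ψ.1.2 L).1 := by
      rw [← hφ]
      exact (ψ.2 (Q f) L).2 hf
    have h2 : graphSubspace (φ f') ≤ (ψ.1.2 L).1 := by
      rw [← hφ]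
      exact (ψ.2 (Q f') L).2 hfL
    have h3 : graphSubspace (φ f) ≤ (QuotientGroup.mk g : PGammaL F V) • L.1 := by
      rw [← hpt]
      exact (PGammaL.smul_le_smul_iff _).2 hf
    have h4 : graphSubspace (φ f') ≤ (QuotientGroup.mk g : PGammaL F V) • L.1 := by
      rw [← hpt]
      exact (PGammaL.smul_le_smul_iff _).2 hfL
    have hL1 : finrank F (ψ.1.2 L).1 = t + 1 := (ψ.1.2 L).2.1
    have hL2 : finrank F ((QuotientGroup.mk g : PGammaL F V) • L.1 : Submodule F V) = t + 1 :=
      (PGammaL.finrank_smul _ _).trans L.2.1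
    -- Two distinct points on `L` determine its image: their images are distinct `t`-spaces, so
    -- their join fills any subspace of vector dimension `t + 1` containing both.
    have hlt : graphSubspace (φ f) < graphSubspace (φ f) ⊔ graphSubspace (φ f') := by
      refine lt_of_le_of_ne le_sup_left fun h => hne (graphSubspace_injective hc ?_)
      refine (eq_of_le_of_finrank_eq (sup_eq_left.1 h.symm) ?_).symm
      rw [finrank_graphSubspace hc, finrank_graphSubspace hc]
    have hlt' := finrank_lt_finrank_of_lt hlt
    rw [finrank_graphSubspace hc, htT] at hlt'
    rw [← eq_of_le_of_finrank_le (sup_le h1 h2) (by omega),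
      ← eq_of_le_of_finrank_le (sup_le h3 h4) (by omega)]

theorem stabilizerToAut_injective [Finite F] [FiniteDimensional F V] {t : ℕ}
    {π : Submodule F V} (ht : 1 ≤ t) (hπ : 1 ≤ finrank F π)
    (hV : finrank F V = finrank F π + t) :
    Function.Injective (stabilizerToAut π t) := by
  obtain ⟨T, hT⟩ := Submodule.exists_isCompl π
  have hc : IsCompl T π := hT.symm
  have htT : finrank F T = t := by
    have := finrank_sup_add_finrank_inf_eq T π
    rw [hc.sup_eq_top, hc.inf_eq_bot, finrank_top, finrank_bot] at this
    omega
  rw [injective_iff_map_eq_one]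
  rintro ⟨g, hg⟩ h
  refine Subtype.ext ?_
  induction g using QuotientGroup.induction_on with
  | H g =>
    refine (QuotientGroup.eq_one_iff g).2 (mem_scalars_of_fix_graphSubspace hc ?_ ?_ hg fun f => ?_)
    · rintro rfl
      simp at htT
      omega
    · rintro rfl
      simp at hπ
    · let A : (geometryX π t).Point :=
        ⟨graphSubspace f, (finrank_graphSubspace hc f).trans htT, graphSubspace_inf hc f⟩
      have h1 := (stabilizerToAut_isInducedBy (t := t)
        (⟨QuotientGroup.mk g, hg⟩ : MulAction.stabilizer (PGammaL F V) π)).1 A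
      rw [h] at h1
      exact h1.symm

end Main

theorem mainTheorem2 {F V : Type*} [Field F] [Finite F] [AddCommGroup V] [Module F V]
    (n t : ℕ) (hn : 1 ≤ n) (ht : 1 ≤ t) (htq : 2 ≤ t ∨ 3 ≤ Nat.card F)
    (hV : Module.finrank F V = n + t + 1)
    (π : Submodule F V) (hπ : Module.finrank F π = n + 1) :
    (∀ ψ : (geometryX π t).Aut, ∃ g : PGammaL F V, g • π = π ∧ IsInducedBy ψ g) ∧
    ∃ e : MulAction.stabilizer (PGammaL F V) π ≃* (geometryX π t).Aut,
      ∀ g : MulAction.stabilizer (PGammaL F V) π, IsInducedBy (e g) g.1 := by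
  have : FiniteDimensional F V := FiniteDimensional.of_finrank_pos (by omega)
  have hex := exists_collineation n t hn ht htq hV π hπ
  refine ⟨hex, MulEquiv.ofBijective (stabilizerToAut π t)
    ⟨stabilizerToAut_injective ht (by omega) (by omega), fun ψ => ?_⟩,
    stabilizerToAut_isInducedBy⟩
  obtain ⟨g, hg, hψ⟩ := hex ψ
  exact ⟨⟨g, hg⟩, (stabilizerToAut_isInducedBy _).unique hψ⟩
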